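/- Let $w$ be a finite word over the alphabet $\{a,b\}$ (with $a\neq b$) in which both letters occur, and write $w=a^{r_1}ba^{r_2}ba^{r_3}b\cdots a^{r_k}ba^{r_{k+1}}$, where $k\ge 1$ is the number of occurrences of $b$ in $w$, $r_1,r_2,\dots,r_{k+1}$ are nonnegative integers and $a^n$ denotes the word consisting of $n$ letters $a$. Let $\sigma$ be a permutation of $\{1,2,\dots,k+1\}$ such that $r_{\sigma(1)}\le r_{\sigma(2)}\le\dots\le r_{\sigma(k+1)}$. Let $m(w)$ denote the number of distinct nonempty powers of exponent at least $2$ in $w$, that is, the number of distinct nonempty words of the form $u^n=uu\cdots u$ ($n$ copies of a word $u$, $n\ge 2$) that are contiguous factors of $w$, and let $|w|$ denote the length of $w$. Then $$m(w)+r_{\sigma(k)}\le |w|-2 .$$ -/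

import Mathlib

/-- The `n`-th power of a word `u`: the concatenation of `n` copies of `u`. -/
def wordPow {α : Type*} (u : List α) (n : ℕ) : List α :=
  (List.replicate n u).flatten

/-- The set of nonempty powers of exponent at least `2` occurring in `w`: the nonempty (contiguous)
factors of `w` of the form `u ^ n` with `n ≥ 2`. -/
def powerSet {α : Type*} (w : List α) : Set (List α) :=
  {v | v ≠ [] ∧ v <:+: w ∧ ∃ (u : List α) (n : ℕ), 2 ≤ n ∧ v = wordPow u n}

/-- Only finitely many powers occur in a finite word, so that counting them by `Set.ncard` below
gives the true number. -/
theorem powerSet_finite {α : Type*} (w : List α) : (powerSet w).Finite := by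
  refine (w.sublists.finite_toSet).subset ?_
  rintro v ⟨-, hv, -⟩
  exact List.mem_sublists.2 hv.sublist

/-- `numPowers w` is the number of distinct nonempty powers of exponent at least `2` in `w`. -/
noncomputable def numPowers {α : Type*} (w : List α) : ℕ :=
  (powerSet w).ncard

/-- The word `a^{r 0} b a^{r 1} b ⋯ a^{r (k-1)} b a^{r k}`, with `k` occurrences of the
separator `b`. -/
def blockWord {α : Type*} (a b : α) {k : ℕ} (r : Fin (k + 1) → ℕ) : List α :=
  (List.ofFn fun i : Fin k => List.replicate (r i.castSucc) a ++ [b]).flatten ++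
    List.replicate (r (Fin.last k)) a

/-! Let Γₙ be the graph whose vertices and edges are the factors of w of lengths n and n+1; w traces
a walk through all of it, so Γₙ is connected. With c(n) vertices, at most c(n+1) − c(n) + 1 edges
can be deleted while keeping it connected. One edge can be deleted per circuit of length at most n:
the edge starting at the circuit's Lyndon rotation can reappear elsewhere on another circuit only if
that one is strictly longer, so induction on length works (`chosenEdges_potential`). Powers inject
into pairs (n, circuit of Γₙ) (`numPowers_le_sum_card_circuits`), and telescoping from c(1) ≥ 2 to
c(|w|) = 1 bounds m(w) by |w| − 2. For each positive n up to the second largest run of a, the edge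
aⁿb lies on no such circuit and can be deleted too, which gains the extra term. -/

/-- The factor of length `n` of the infinite word `f` that starts at position `s`. -/
def window {α : Type*} (f : ℕ → α) (s n : ℕ) : List α :=
  (List.range n).map fun i => f (s + i)

/-- The shift map on infinite words. -/
def shift {α : Type*} (f : ℕ → α) : ℕ → α := fun i => f (i + 1)

theorem shift_iterate {α : Type*} (f : ℕ → α) (s i : ℕ) : (shift^[s] f) i = f (i + s) := by
  induction s generalizing i with
  | zero => rfl
  | succ s ih => rw [Function.iterate_succ_apply', shift, ih]; congr 1; omega

@[simp] theorem length_window {α : Type*} (f : ℕ → α) (s n : ℕ) : (window f s n).length = n := by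
  simp [window]

theorem window_eq_iff {α : Type*} {f g : ℕ → α} {s t n : ℕ} :
    window f s n = window g t n ↔ ∀ i < n, f (s + i) = g (t + i) := by
  simp [window]

theorem window_add {α : Type*} (f : ℕ → α) (s m n : ℕ) :
    window f s (m + n) = window f s m ++ window f (s + m) n := by
  simp [window, List.range_add, add_assoc]

theorem window_isInfix {α : Type*} (f : ℕ → α) {s t m n : ℕ} (hs : s ≤ t) (ht : t + m ≤ s + n) :
    window f t m <:+: window f s n := by
  obtain ⟨j, rfl⟩ := Nat.exists_eq_add_of_le hs
  obtain ⟨l, rfl⟩ : ∃ l, n = j + m + l := ⟨n - (j + m), by omega⟩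
  rw [window_add, window_add]
  exact ⟨_, _, rfl⟩

theorem take_window_succ {α : Type*} (f : ℕ → α) (s n : ℕ) :
    (window f s (n + 1)).take n = window f s n := by
  rw [window_add, List.take_left' (length_window f s n)]

theorem tail_window_succ {α : Type*} (f : ℕ → α) (s n : ℕ) :
    (window f s (n + 1)).tail = window f (s + 1) n := by
  rw [add_comm n 1, window_add]
  simp [window]

theorem window_getD {α : Type*} (w : List α) (a : α) :
    window (fun i => w.getD i a) 0 w.length = w := by
  apply List.ext_getElem
  · simp
  · intro i h1 h2
    simp [window, h2]

theorem window_getD_isInfix {α : Type*} (w : List α) (a : α) {i n : ℕ} (h : i + n ≤ w.length) :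
    window (fun i => w.getD i a) i n <:+: w := by
  conv_rhs => rw [← window_getD w a]
  exact window_isInfix _ (Nat.zero_le _) (by omega)

theorem window_getD_append {α : Type*} (x v y : List α) (a : α) :
    window (fun i => (x ++ v ++ y).getD i a) x.length v.length = v := by
  apply List.ext_getElem
  · simp
  · intro i h1 h2
    simp [window, h2, List.getElem?_append]

theorem exists_window_getD {α : Type*} {w v : List α} (a : α) (h : v <:+: w) :
    ∃ i, i + v.length ≤ w.length ∧ window (fun i => w.getD i a) i v.length = v := by
  obtain ⟨x, y, rfl⟩ := h
  exact ⟨x.length, by simp, window_getD_append x v y a⟩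

/-! ### Periodic infinite words -/

section Periodic

variable {α : Type*}

theorem add_minimalPeriod (f : ℕ → α) (i k : ℕ) :
    f (i + k * Function.minimalPeriod shift f) = f i := by
  rw [← shift_iterate f, mul_comm]
  exact congrFun (((Function.isPeriodicPt_minimalPeriod shift f).mul_const k).eq) i

theorem add_minimalPeriod_one (f : ℕ → α) (i : ℕ) :
    f (i + Function.minimalPeriod shift f) = f i := by
  simpa using add_minimalPeriod f i 1

theorem mod_minimalPeriod (f : ℕ → α) (i : ℕ) :
    f (i % Function.minimalPeriod shift f) = f i := by
  conv_rhs => rw [← Nat.mod_add_div i (Function.minimalPeriod shift f),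
    mul_comm (Function.minimalPeriod shift f), add_minimalPeriod f]

theorem eq_of_agree {f g : ℕ → α} (hf : f ∈ Function.periodicPts shift)
    (h : Function.minimalPeriod shift f = Function.minimalPeriod shift g)
    (hfg : ∀ i < Function.minimalPeriod shift f, f i = g i) : f = g := by
  ext i
  rw [← mod_minimalPeriod f i, ← mod_minimalPeriod g i, ← h]
  exact hfg _ (Nat.mod_lt _ (Function.minimalPeriod_pos_of_mem_periodicPts hf))

variable [LinearOrder α]

/-- `f` is a Lyndon sequence: periodic, and lexicographically least among its shifts. -/
def IsLyndonSeq (f : ℕ → α) : Prop :=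
  f ∈ Function.periodicPts shift ∧ ∀ s, toLex f ≤ toLex (shift^[s] f)

/-- A Lyndon word has no proper border: rotating a border to the front would give a smaller
rotation. -/
theorem IsLyndonSeq.exists_ne {f : ℕ → α} (hf : IsLyndonSeq f) {q : ℕ} (hq : 0 < q)
    (hqp : q < Function.minimalPeriod shift f) :
    ∃ i, i + q < Function.minimalPeriod shift f ∧ f (i + q) ≠ f i := by
  by_contra! H
  have hne : shift^[q] f ≠ f := Function.not_isPeriodicPt_of_pos_of_lt_minimalPeriod hq.ne' hqp
  have hlt : toLex f < toLex (shift^[q] f) := lt_of_le_of_ne (hf.2 q) fun h => hne h.symm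
  obtain ⟨i, hi, hlt⟩ := hlt
  set p := Function.minimalPeriod shift f with hp
  have hlt' : f i < f (i + q) := by rw [← shift_iterate f]; exact hlt
  have hi' : ∀ j < i, f j = f (j + q) := fun j hj => by rw [← shift_iterate f]; exact hi j hj
  have hip : p ≤ i + q := by
    by_contra! h
    exact hlt'.ne (H i h).symm
  -- Shifting by p - q moves the border to the front, and the first discrepancy at i then reads in
  -- the opposite direction.
  refine not_lt_of_ge (hf.2 (p - q)) ⟨i - (p - q), fun j hj => ?_, ?_⟩
  · change (shift^[p - q] f) j = f j
    rw [shift_iterate, hi' _ (by omega), ← add_minimalPeriod_one f j]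
    congr 1; omega
  · change (shift^[p - q] f) (i - (p - q)) < f (i - (p - q))
    rw [shift_iterate, ← add_minimalPeriod_one f (i - (p - q))]
    convert hlt' using 2 <;> omega

theorem IsLyndonSeq.minimalPeriod_le {f g : ℕ → α} (hf : IsLyndonSeq f)
    (hg : g ∈ Function.periodicPts shift) {n j : ℕ} (hn : Function.minimalPeriod shift f ≤ n)
    (h : window f 0 n = window g j n) :
    Function.minimalPeriod shift f ≤ Function.minimalPeriod shift g := by
  by_contra! hlt
  obtain ⟨i, hi, hne⟩ := hf.exists_ne (Function.minimalPeriod_pos_of_mem_periodicPts hg) hlt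
  rw [window_eq_iff] at h
  have h1 := h i (by omega)
  have h2 := h (i + Function.minimalPeriod shift g) (by omega)
  rw [← add_assoc j, add_minimalPeriod_one g, ← h1] at h2
  simp only [zero_add] at h2
  exact hne h2

theorem IsLyndonSeq.window_injOn {f g : ℕ → α} (hf : IsLyndonSeq f) (hg : IsLyndonSeq g) {n : ℕ}
    (hfn : Function.minimalPeriod shift f ≤ n) (hgn : Function.minimalPeriod shift g ≤ n)
    (h : window f 0 n = window g 0 n) : f = g := by
  refine eq_of_agree hf.1 (le_antisymm (hf.minimalPeriod_le hg.1 hfn h)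
    (hg.minimalPeriod_le hf.1 hgn h.symm)) fun i hi => ?_
  simpa using window_eq_iff.1 h i (by omega)

/-- With equal periods, f would be a nontrivial rotation of g; both being least, they would
coincide, against minimality of the period. This drives the induction on circuits. -/
theorem IsLyndonSeq.minimalPeriod_lt {f g : ℕ → α} (hf : IsLyndonSeq f) (hg : IsLyndonSeq g)
    {n j : ℕ} (hn : Function.minimalPeriod shift f ≤ n) (hj : 0 < j)
    (hjg : j < Function.minimalPeriod shift g) (h : window f 0 n = window g j n) :
    Function.minimalPeriod shift f < Function.minimalPeriod shift g := by
  refine lt_of_le_of_ne (hf.minimalPeriod_le hg.1 hn h) fun heq => ?_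
  have hfg : f = shift^[j] g := by
    refine eq_of_agree hf.1 ?_ fun i hi => ?_
    · rw [heq, Function.minimalPeriod_apply_iterate hg.1]
    · rw [shift_iterate, add_comm i j]
      simpa using window_eq_iff.1 h i (by omega)
  have hgf : g = shift^[Function.minimalPeriod shift g - j] f := by
    rw [hfg, ← Function.iterate_add_apply, Nat.sub_add_cancel hjg.le,
      Function.iterate_minimalPeriod]
  have h1 : toLex g ≤ toLex f := by rw [hfg]; exact hg.2 j
  have h2 : toLex f ≤ toLex g := by rw [hgf]; exact hf.2 _
  have h3 : f = g := toLex.injective (le_antisymm h2 h1)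
  exact Function.not_isPeriodicPt_of_pos_of_lt_minimalPeriod hj.ne' hjg (hfg.symm.trans h3)

theorem exists_isLyndonSeq {f : ℕ → α} (hf : f ∈ Function.periodicPts shift) :
    ∃ g, IsLyndonSeq g ∧ Function.minimalPeriod shift g = Function.minimalPeriod shift f ∧
      ∃ s < Function.minimalPeriod shift f, f = shift^[s] g := by
  have hp := Function.minimalPeriod_pos_of_mem_periodicPts hf
  obtain ⟨m, hm, hmin⟩ := (Finset.range (Function.minimalPeriod shift f)).exists_min_image
    (fun s => toLex (shift^[s] f)) ⟨0, by simpa using hp⟩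
  rw [Finset.mem_range] at hm
  refine ⟨shift^[m] f, ⟨?_, fun s => ?_⟩, Function.minimalPeriod_apply_iterate hf m, ?_⟩
  · obtain ⟨n, hn, h⟩ := hf
    exact ⟨n, hn, h.apply_iterate m⟩
  · rw [← Function.iterate_add_apply, ← Function.iterate_mod_minimalPeriod_eq (n := s + m)]
    exact hmin _ (Finset.mem_range.2 (Nat.mod_lt _ hp))
  · refine ⟨(Function.minimalPeriod shift f - m) % Function.minimalPeriod shift f,
      Nat.mod_lt _ hp, ?_⟩
    rw [← Function.minimalPeriod_apply_iterate hf m, Function.iterate_mod_minimalPeriod_eq,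
      Function.minimalPeriod_apply_iterate hf m, ← Function.iterate_add_apply,
      Nat.sub_add_cancel hm.le, Function.iterate_minimalPeriod]

end Periodic

/-! ### Powers as windows of Lyndon sequences -/

theorem wordPow_eq_window {α : Type*} {u : List α} (hu : u ≠ []) (n : ℕ) :
    wordPow u n = window (fun i => u[i % u.length]'(Nat.mod_lt _ (List.length_pos_iff.2 hu)))
      0 (n * u.length) := by
  induction n with
  | zero => simp [wordPow, window]
  | succ n ih =>
    rw [wordPow, List.replicate_succ', List.flatten_append, ← wordPow, ih, Nat.succ_mul, window_add]
    congr 1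
    apply List.ext_getElem
    · simp
    · intro i h1 h2
      have : i < u.length := by simpa using h1
      simp [window, Nat.mod_eq_of_lt this]

theorem exists_window_of_mem_powerSet {α : Type*} [LinearOrder α] {w v : List α}
    (hv : v ∈ powerSet w) :
    ∃ (f : ℕ → α) (K s : ℕ), IsLyndonSeq f ∧ 2 ≤ K ∧ s < Function.minimalPeriod shift f ∧
      v = window f s (K * Function.minimalPeriod shift f) := by
  obtain ⟨hv0, -, u, n, hn, rfl⟩ := hv
  have hu : u ≠ [] := by
    rintro rfl
    exact hv0 (by simp [wordPow])
  have hul := List.length_pos_iff.2 hu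
  have hper : Function.IsPeriodicPt shift u.length
      (fun i => u[i % u.length]'(Nat.mod_lt _ hul)) := by
    funext i
    simp [shift_iterate]
  rw [wordPow_eq_window hu]
  set f : ℕ → α := fun i => u[i % u.length]'(Nat.mod_lt _ hul) with hf
  obtain ⟨g, hg, hgf, s, hs, hfs⟩ := exists_isLyndonSeq (Function.mk_mem_periodicPts hul hper)
  obtain ⟨c, hc⟩ := hper.minimalPeriod_dvd
  refine ⟨g, n * c, s, hg, ?_, hgf ▸ hs, ?_⟩
  · have : c ≠ 0 := by rintro rfl; omega
    nlinarith [Nat.pos_of_ne_zero this]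
  · rw [hgf, mul_assoc, mul_comm c, ← hc, window_eq_iff]
    intro i _
    conv_lhs => rw [hfs, shift_iterate]
    congr 1; omega

/-! ### The graph of factors -/

open scoped Classical in
/-- The factors of `w` of length `n`. -/
noncomputable def factors {α : Type*} (w : List α) (n : ℕ) : Finset (List α) :=
  w.sublists.toFinset.filter fun v => v <:+: w ∧ v.length = n

theorem mem_factors {α : Type*} {w v : List α} {n : ℕ} :
    v ∈ factors w n ↔ v <:+: w ∧ v.length = n := by
  simp only [factors, Finset.mem_filter, List.mem_toFinset, List.mem_sublists]
  exact ⟨fun h => h.2, fun h => ⟨h.1.sublist, h⟩⟩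

theorem card_factors_length {α : Type*} (w : List α) : (factors w w.length).card = 1 := by
  rw [Finset.card_eq_one]
  refine ⟨w, Finset.ext fun v => ?_⟩
  rw [mem_factors, Finset.mem_singleton]
  exact ⟨fun h => h.1.eq_of_length h.2, fun h => h ▸ ⟨List.infix_rfl, rfl⟩⟩

/-- A connected graph has at most one more vertex than edges. Connectivity is expressed by
potentials: the edge differences together with one value determine a function on S, so dimensions
compare. -/
theorem card_le_card_add_one_of_connected {V E : Type*} (S : Finset V) (T : Finset E)
    (src tgt : E → V)
    (h : ∀ g : V → ℚ, (∀ e ∈ T, g (src e) = g (tgt e)) → ∀ x ∈ S, ∀ y ∈ S, g x = g y) :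
    S.card ≤ T.card + 1 := by
  classical
  rcases S.eq_empty_or_nonempty with rfl | ⟨x₀, hx₀⟩
  · simp
  let ext : (S → ℚ) →ₗ[ℚ] (V → ℚ) :=
    { toFun := fun g v => if hv : v ∈ S then g ⟨v, hv⟩ else 0
      map_add' := fun g g' => by ext v; by_cases hv : v ∈ S <;> simp [hv]
      map_smul' := fun c g => by ext v; by_cases hv : v ∈ S <;> simp [hv] }
  have hext : ∀ g (x : S), ext g x = g x := fun g x => by simp [ext]
  let φ : (S → ℚ) →ₗ[ℚ] (T → ℚ) × ℚ :=
    { toFun := fun g => (fun e => ext g (src e) - ext g (tgt e), ext g x₀)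
      map_add' := fun g g' => by
        exact Prod.ext (funext fun e => by simp; ring) (by simp)
      map_smul' := fun c g => by
        exact Prod.ext (funext fun e => by simp; ring) (by simp) }
  have hφ : Function.Injective φ := by
    rw [← LinearMap.ker_eq_bot, LinearMap.ker_eq_bot']
    intro g hg
    have h0 : ext g x₀ = 0 := congrArg Prod.snd hg
    have h1 : ∀ e ∈ T, ext g (src e) = ext g (tgt e) := fun e he =>
      sub_eq_zero.1 (congrFun (congrArg Prod.fst hg) ⟨e, he⟩)
    ext x
    rw [← hext g x, h _ h1 x x.2 x₀ hx₀, h0]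
    rfl
  simpa using LinearMap.finrank_le_finrank_of_injective hφ

theorem eq_of_potential (w : List α) (n : ℕ) (G : List α → ℚ)
    (hG : ∀ e ∈ factors w (n + 1), G (e.take n) = G e.tail) :
    ∀ x ∈ factors w n, ∀ y ∈ factors w n, G x = G y := by
  rcases w with _ | ⟨a, w'⟩
  · intro x hx y hy
    rw [mem_factors, List.infix_nil] at hx hy
    rw [hx.1, hy.1]
  set w := a :: w'
  have key : ∀ i, i + n ≤ w.length →
      G (window (fun i => w.getD i a) i n) = G (window (fun i => w.getD i a) 0 n) := by
    intro i
    induction i with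
    | zero => simp
    | succ i ih =>
      intro hi
      rw [← ih (by omega), ← take_window_succ _ i n, ← tail_window_succ]
      exact (hG _ (mem_factors.2 ⟨window_getD_isInfix w a (by omega), length_window _ _ _⟩)).symm
  have key' : ∀ x ∈ factors w n, G x = G (window (fun i => w.getD i a) 0 n) := by
    intro x hx
    obtain ⟨hxw, rfl⟩ := mem_factors.1 hx
    obtain ⟨i, hi, h⟩ := exists_window_getD a hxw
    rw [← key i hi, h]
  exact fun x hx y hy => (key' x hx).trans (key' y hy).symm

theorem card_le_card_of_fiberwise {A B C : Type*} [DecidableEq C] (P : Finset A) (Q : Finset B)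
    (φ : A → C) (ψ : B → C)
    (h : ∀ c ∈ P.image φ, (P.filter fun x => φ x = c).card ≤ (Q.filter fun x => ψ x = c).card) :
    P.card ≤ Q.card := by
  rw [Finset.card_eq_sum_card_image φ P]
  refine (Finset.sum_le_sum h).trans ?_
  rw [Finset.sum_card_fiberwise_eq_card_filter]
  exact Finset.card_filter_le _ _

/-- If `t` conjugates of a `K`-th power occur in `w`, so do all windows of length
`(K - 1) * p + t` of the periodic word. -/
theorem window_isInfix_of_card_le {w : List α} {f : ℕ → α} (hf : f ∈ Function.periodicPts shift)
    (K x : ℕ) (S : Finset ℕ) (hS : S ⊆ Finset.range (Function.minimalPeriod shift f))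
    (hSne : S.Nonempty)
    (hSw : ∀ s ∈ S, window f s ((K + 1) * Function.minimalPeriod shift f) <:+: w) :
    window f x (K * Function.minimalPeriod shift f + S.card) <:+: w := by
  set p := Function.minimalPeriod shift f
  have hp : 0 < p := Function.minimalPeriod_pos_of_mem_periodicPts hf
  have hcard : S.card ≤ p := by simpa using Finset.card_le_card hS
  have hSpos := hSne.card_pos
  -- T holds the residues of the starts from which a window of length (K+1)p covers the wanted one,
  -- translated by p to avoid truncated subtraction. Since |S| + |T| = p + 1, the two sets meet.
  set T := (Finset.range (p - S.card + 1)).image fun j => (x + p - j) % p with hT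
  have hTcard : T.card = p - S.card + 1 := by
    rw [hT, Finset.card_image_of_injOn, Finset.card_range]
    intro i hi j hj hij
    simp only [Finset.coe_range, Set.mem_Iio] at hi hj
    have h1 : (x + p - i) ≡ (x + p - j) [MOD p] := hij
    have h2 : i ≡ j [MOD p] := by
      have e1 := h1.add_right (i + j)
      rw [show x + p - i + (i + j) = j + (x + p) by omega,
        show x + p - j + (i + j) = i + (x + p) by omega] at e1
      exact (Nat.ModEq.add_right_cancel' _ e1).symm
    exact h2.eq_of_lt_of_lt (by omega) (by omega)
  have hTr : T ⊆ Finset.range p := by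
    intro i hi
    obtain ⟨j, -, rfl⟩ := Finset.mem_image.1 hi
    exact Finset.mem_range.2 (Nat.mod_lt _ hp)
  obtain ⟨s, hs⟩ : (S ∩ T).Nonempty := by
    rw [Finset.nonempty_iff_ne_empty]
    intro h
    have h1 := Finset.card_union_add_card_inter S T
    have h2 := Finset.card_le_card (Finset.union_subset hS hTr)
    rw [h, Finset.card_empty] at h1
    rw [Finset.card_range] at h2
    omega
  rw [Finset.mem_inter] at hs
  obtain ⟨j, hj, rfl⟩ := Finset.mem_image.1 hs.2
  rw [Finset.mem_range] at hj
  have h1 := hSw _ hs.1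
  have h2 : window f ((x + p - j) % p) ((K + 1) * p) = window f (x + p - j) ((K + 1) * p) := by
    rw [window_eq_iff]
    intro i _
    rw [← mod_minimalPeriod f, ← mod_minimalPeriod f (x + p - j + i)]
    congr 1
    exact Nat.mod_add_mod _ _ _
  have h3 : window f x (K * p + S.card) = window f (x + p) (K * p + S.card) := by
    rw [window_eq_iff]
    intro i _
    rw [show x + p + i = x + i + p by omega]
    exact (add_minimalPeriod_one f _).symm
  rw [h2] at h1
  rw [h3]
  refine (window_isInfix f (by omega) ?_).trans h1
  rw [Nat.succ_mul]
  omega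

/-! ### Circuits and removable edges -/

section Circuits

variable {α : Type*} [LinearOrder α]

/-- The circuits of length at most `n` in the graph whose vertices and edges are the factors of `w`
of length `n` and `n + 1`, given by Lyndon sequences. -/
def circuits (w : List α) (n : ℕ) : Set (ℕ → α) :=
  {f | IsLyndonSeq f ∧ Function.minimalPeriod shift f ≤ n ∧ ∀ s, window f s (n + 1) <:+: w}

theorem window_injOn_circuits (w : List α) (n : ℕ) :
    Set.InjOn (fun f => window f 0 (n + 1)) (circuits w n) := fun _ hf _ hg h =>
  hf.1.window_injOn hg.1 (hf.2.1.trans n.le_succ) (hg.2.1.trans n.le_succ) h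

theorem circuits_finite (w : List α) (n : ℕ) : (circuits w n).Finite := by
  refine Set.Finite.of_finite_image ((factors w (n + 1)).finite_toSet.subset ?_)
    (window_injOn_circuits w n)
  rintro _ ⟨f, hf, rfl⟩
  exact mem_factors.2 ⟨hf.2.2 0, length_window _ _ _⟩

/-- The circuits of length at most `n` as a finset. -/
noncomputable def circuitFinset (w : List α) (n : ℕ) : Finset (ℕ → α) :=
  (circuits_finite w n).toFinset

theorem mem_circuitFinset {w : List α} {n : ℕ} {f : ℕ → α} :
    f ∈ circuitFinset w n ↔ IsLyndonSeq f ∧ Function.minimalPeriod shift f ≤ n ∧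
      ∀ s, window f s (n + 1) <:+: w :=
  Set.Finite.mem_toFinset _

/-- One edge chosen on each circuit. -/
noncomputable def chosenEdges (w : List α) (n : ℕ) : Finset (List α) :=
  (circuitFinset w n).image fun f => window f 0 (n + 1)

theorem card_chosenEdges (w : List α) (n : ℕ) :
    (chosenEdges w n).card = (circuitFinset w n).card :=
  Finset.card_image_of_injOn fun _ hf _ hg h =>
    window_injOn_circuits w n (mem_circuitFinset.1 hf) (mem_circuitFinset.1 hg) h

theorem chosenEdges_subset (w : List α) (n : ℕ) : chosenEdges w n ⊆ factors w (n + 1) := by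
  intro e he
  obtain ⟨f, hf, rfl⟩ := Finset.mem_image.1 he
  exact mem_factors.2 ⟨(mem_circuitFinset.1 hf).2.2 0, length_window _ _ _⟩

/-- A potential that is preserved by all edges that are not chosen (nor in a set `X` of edges that
lie on no circuit) is preserved by the chosen edges. -/
theorem chosenEdges_potential (w : List α) (n : ℕ) (X : Finset (List α))
    (hX : ∀ f ∈ circuitFinset w n, ∀ j, window f j (n + 1) ∉ X) (G : List α → ℚ)
    (hG : ∀ e ∈ factors w (n + 1) \ (chosenEdges w n ∪ X), G (e.take n) = G e.tail) :
    ∀ e ∈ factors w (n + 1) \ X, G (e.take n) = G e.tail := by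
  have key : ∀ p, ∀ f ∈ circuitFinset w n, Function.minimalPeriod shift f = p →
      G (window f 0 n) = G (window f 1 n) := by
    intro p
    induction p using Nat.strong_induction_on with
    | _ p ih =>
    intro f hf hp
    have hf' := mem_circuitFinset.1 hf
    have step : ∀ j, j + 1 < p → G (window f (j + 1) n) = G (window f (j + 1 + 1) n) := by
      intro j hj
      -- A chosen edge met away from offset 0 belongs to a strictly shorter circuit, so the
      -- induction hypothesis applies.
      by_cases hc : window f (j + 1) (n + 1) ∈ chosenEdges w n
      · obtain ⟨h, hh, he⟩ := Finset.mem_image.1 hc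
        have hh' := mem_circuitFinset.1 hh
        have hlt := hh'.1.minimalPeriod_lt hf'.1 (hh'.2.1.trans n.le_succ) j.succ_pos
          (hp ▸ hj) he
        have := ih _ (hp ▸ hlt) h hh rfl
        rwa [← take_window_succ h, ← tail_window_succ h, he, take_window_succ,
          tail_window_succ] at this
      · have := hG (window f (j + 1) (n + 1)) (by
          rw [Finset.mem_sdiff, Finset.mem_union, not_or]
          exact ⟨mem_factors.2 ⟨hf'.2.2 _, length_window _ _ _⟩, hc, hX f hf _⟩)
        rwa [take_window_succ, tail_window_succ] at this
    have hpos : 0 < p := hp ▸ Function.minimalPeriod_pos_of_mem_periodicPts hf'.1.1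
    have walk : ∀ j, j + 1 ≤ p → G (window f 1 n) = G (window f (j + 1) n) := by
      intro j
      induction j with
      | zero => simp
      | succ j ihj => exact fun hj => (ihj (by omega)).trans (step j (by omega))
    have h0 : window f 0 n = window f (p - 1 + 1) n := by
      rw [window_eq_iff]
      intro i _
      rw [Nat.sub_add_cancel hpos, ← hp, zero_add, add_comm, add_minimalPeriod_one f]
    rw [h0, walk (p - 1) (by omega)]
  intro e he
  rw [Finset.mem_sdiff] at he
  by_cases hc : e ∈ chosenEdges w n
  · obtain ⟨f, hf, rfl⟩ := Finset.mem_image.1 hc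
    rw [take_window_succ, tail_window_succ]
    exact key _ f hf rfl
  · exact hG e (by simp [he.1, he.2, hc])

theorem card_factors_add_card_circuits_add_le (w : List α) (n : ℕ) (X : Finset (List α))
    (hXw : X ⊆ factors w (n + 1))
    (hX : ∀ f ∈ circuitFinset w n, ∀ j, window f j (n + 1) ∉ X)
    (hG : ∀ G : List α → ℚ, (∀ e ∈ factors w (n + 1) \ X, G (e.take n) = G e.tail) →
      ∀ e ∈ X, G (e.take n) = G e.tail) :
    (factors w n).card + (circuitFinset w n).card + X.card ≤ (factors w (n + 1)).card + 1 := by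
  have h := card_le_card_add_one_of_connected (factors w n)
    (factors w (n + 1) \ (chosenEdges w n ∪ X)) (fun e => e.take n) (fun e => e.tail)
    fun G h => eq_of_potential w n G fun e he => by
      have h' := chosenEdges_potential w n X hX G h
      by_cases heX : e ∈ X
      · exact hG G h' e heX
      · exact h' e (Finset.mem_sdiff.2 ⟨he, heX⟩)
  have hd : Disjoint (chosenEdges w n) X := by
    rw [Finset.disjoint_left]
    intro e he
    obtain ⟨f, hf, rfl⟩ := Finset.mem_image.1 he
    exact hX f hf 0
  have hsub : chosenEdges w n ∪ X ⊆ factors w (n + 1) :=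
    Finset.union_subset (chosenEdges_subset w n) hXw
  have hle := Finset.card_le_card hsub
  rw [Finset.card_sdiff_of_subset hsub] at h
  rw [Finset.card_union_of_disjoint hd, card_chosenEdges] at h hle
  omega

/-- A period p ≤ n would identify the final b of aⁿb with an earlier a, so this edge is on no
counted circuit. It is still removable, because w returns from its end to aⁿ without using it. -/
theorem card_factors_add_card_circuits_le_of_two_runs {a b : α} (hab : a ≠ b) {w : List α} {n : ℕ}
    {x y : List α} (hw : w = x ++ (List.replicate n a ++ [b]) ++ y)
    (hy : List.replicate n a <:+: y) :
    (factors w n).card + (circuitFinset w n).card + 1 ≤ (factors w (n + 1)).card + 1 := by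
  set e₀ := List.replicate n a ++ [b] with he₀
  have hlen : e₀.length = n + 1 := by simp [he₀]
  have hfac : e₀ ∈ factors w (n + 1) := mem_factors.2 ⟨⟨x, y, hw.symm⟩, hlen⟩
  refine card_factors_add_card_circuits_add_le w n {e₀} (by simpa using hfac) ?_ ?_
  · intro f hf j hj
    rw [Finset.mem_singleton] at hj
    obtain ⟨hL, hn, -⟩ := mem_circuitFinset.1 hf
    set p := Function.minimalPeriod shift f
    have hp : 0 < p := Function.minimalPeriod_pos_of_mem_periodicPts hL.1
    rw [window_add, he₀] at hj
    obtain ⟨h1, h2⟩ := List.append_inj hj (by simp)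
    have hb : f (j + n) = b := by simpa [window] using h2
    have ha : f (j + (n - p)) = a := by
      refine List.eq_of_mem_replicate (n := n) ?_
      rw [← h1, window]
      exact List.mem_map.2 ⟨n - p, by simp; omega, rfl⟩
    apply hab
    rw [← ha, ← hb, ← add_minimalPeriod_one f (j + (n - p))]
    congr 1; omega
  · intro G hG e he
    rw [Finset.mem_singleton] at he
    subst e
    set W : ℕ → α := fun i => w.getD i a with hW
    have hs : window W x.length (n + 1) = e₀ := by
      rw [hW, hw, ← hlen, window_getD_append]
    have htake : e₀.take n = List.replicate n a := by simp [he₀]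
    have hex : ∃ t, x.length < t ∧ t + n ≤ w.length ∧ window W t n = List.replicate n a := by
      obtain ⟨y₁, y₂, rfl⟩ := hy
      refine ⟨(x ++ e₀ ++ y₁).length, by simp; omega, by simp [hw]; omega, ?_⟩
      have := window_getD_append (x ++ e₀ ++ y₁) (List.replicate n a) y₂ a
      rw [List.length_replicate] at this
      rw [hW, hw]
      simpa [List.append_assoc] using this
    classical
    -- Taking the first return to aⁿ ensures that the path in between avoids the edge, which starts
    -- at aⁿ.
    obtain ⟨h1, h2, h3⟩ := Nat.find_spec hex
    have hmin := fun m => Nat.find_min hex (m := m)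
    set t := Nat.find hex
    have walk : ∀ d, x.length + 1 + d ≤ t →
        G (window W (x.length + 1) n) = G (window W (x.length + 1 + d) n) := by
      intro d
      induction d with
      | zero => simp
      | succ d ih =>
        intro hd
        rw [ih (by omega)]
        have := hG (window W (x.length + 1 + d) (n + 1)) (by
          rw [Finset.mem_sdiff, Finset.mem_singleton]
          refine ⟨mem_factors.2 ⟨window_getD_isInfix w a (by omega), length_window _ _ _⟩,
            fun h => hmin (x.length + 1 + d) (by omega) ⟨by omega, by omega, ?_⟩⟩
          rw [← take_window_succ, h, htake])
        rwa [take_window_succ, tail_window_succ] at this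
    have := walk (t - (x.length + 1)) (by omega)
    rw [Nat.add_sub_cancel' (by omega), h3, ← tail_window_succ, hs] at this
    rw [htake, this]

theorem card_factors_add_card_circuits_le (w : List α) (n : ℕ) :
    (factors w n).card + (circuitFinset w n).card ≤ (factors w (n + 1)).card + 1 :=
  card_factors_add_card_circuits_add_le w n ∅ (by simp) (by simp) (by simp)

/-! ### Powers are at most as many as circuits -/

/-- If t rotations of a (k+1)-th power with Lyndon root f of period p occur, then f is a circuit for
n = kp, …, kp + t − 1. As t ≤ p, the value n / p + 1 recovers the exponent, so different exponents
use different n. -/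
theorem numPowers_le_sum_card_circuits (w : List α) :
    numPowers w ≤ ∑ n ∈ Finset.range w.length, (circuitFinset w n).card := by
  classical
  rcases (powerSet w).eq_empty_or_nonempty with h | ⟨v, hv⟩
  · simp [numPowers, h]
  have : Nonempty α := ⟨v.head hv.1⟩
  clear! v
  rw [numPowers, Set.ncard_eq_toFinset_card _ (powerSet_finite w), ← Finset.card_sigma]
  choose! f K s hf hK hs hv using fun v (hv : v ∈ powerSet w) => exists_window_of_mem_powerSet hv
  refine card_le_card_of_fiberwise _ _ (fun v => (f v, K v))
    (fun q : (_ : ℕ) × (ℕ → α) => (q.2, q.1 / Function.minimalPeriod shift q.2 + 1)) ?_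
  intro c hc
  obtain ⟨v₀, hv₀, rfl⟩ := Finset.mem_image.1 hc
  rw [Set.Finite.mem_toFinset] at hv₀
  have hL := hf _ hv₀
  obtain ⟨k, hk⟩ : ∃ k, K v₀ = k + 1 := ⟨K v₀ - 1, by have := hK _ hv₀; omega⟩
  have hk1 : 1 ≤ k := by have := hK _ hv₀; omega
  rw [hk]
  generalize hg : f v₀ = g at *
  set p := Function.minimalPeriod shift g with hpdef
  have hp : 0 < p := Function.minimalPeriod_pos_of_mem_periodicPts hL.1
  set S := (Finset.range p).filter fun s => window g s ((k + 1) * p) <:+: w with hS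
  have hfib : ((powerSet_finite w).toFinset.filter fun x => (f x, K x) = (g, k + 1)).card ≤
      S.card := by
    refine Finset.card_le_card_of_injOn s ?_ ?_
    · intro v hv'
      simp only [Finset.coe_filter, Set.Finite.mem_toFinset, Prod.mk.injEq, Set.mem_ofPred_eq]
        at hv'
      have h1 := hs v hv'.1
      have h2 := hv v hv'.1
      rw [hv'.2.1] at h1 h2
      rw [hv'.2.2] at h2
      simp only [hS, Finset.coe_filter, Finset.mem_range, Set.mem_ofPred_eq]
      exact ⟨h1, h2 ▸ hv'.1.2.1⟩
    · intro v hv' v' hv'' hss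
      simp only [Finset.coe_filter, Set.Finite.mem_toFinset, Prod.mk.injEq, Set.mem_ofPred_eq]
        at hv' hv''
      rw [hv v hv'.1, hv v' hv''.1, hv'.2.1, hv'.2.2, hv''.2.1, hv''.2.2, hss]
  refine hfib.trans ?_
  rw [← Finset.card_range S.card]
  have hScard : S.card ≤ p := by
    simpa using Finset.card_le_card (Finset.filter_subset _ (Finset.range p))
  refine Finset.card_le_card_of_injOn (fun i => ⟨k * p + i, g⟩) ?_ ?_
  · intro i hi
    simp only [Finset.coe_range, Set.mem_Iio] at hi
    have hwin : ∀ x, window g x (k * p + i + 1) <:+: w := fun x =>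
      (window_isInfix g (n := k * p + S.card) le_rfl (by omega)).trans
        (window_isInfix_of_card_le hL.1 k x S (Finset.filter_subset _ _)
          (Finset.card_pos.1 (by omega)) fun s hs => (Finset.mem_filter.1 hs).2)
    simp only [Finset.coe_filter, Finset.mem_sigma, Finset.mem_range, Set.mem_ofPred_eq,
      mem_circuitFinset]
    refine ⟨⟨?_, hL, ?_, hwin⟩, ?_⟩
    · have := (hwin 0).length_le
      rw [length_window] at this
      omega
    · exact le_add_right (Nat.le_mul_of_pos_left p hk1)
    · rw [← hpdef, add_comm (k * p), Nat.add_mul_div_right _ _ hp, Nat.div_eq_of_lt (by omega),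
        zero_add]
  · intro i _ j _ hij
    simpa using hij

theorem circuitFinset_zero (w : List α) : circuitFinset w 0 = ∅ := by
  rw [Finset.eq_empty_iff_forall_notMem]
  intro f hf
  obtain ⟨h1, h2, -⟩ := mem_circuitFinset.1 hf
  have := Function.minimalPeriod_pos_of_mem_periodicPts h1.1
  omega

end Circuits

/-! ### Block words -/

theorem blockWord_succ {α : Type*} (a b : α) {k : ℕ} (r : Fin (k + 1 + 1) → ℕ) :
    blockWord a b r =
      List.replicate (r 0) a ++ [b] ++ blockWord a b fun i : Fin (k + 1) => r i.succ := by
  simp [blockWord, List.ofFn_succ]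

theorem replicate_isInfix_blockWord {α : Type*} (a b : α) {k : ℕ} (r : Fin (k + 1) → ℕ)
    (i : Fin (k + 1)) : List.replicate (r i) a <:+: blockWord a b r := by
  induction k with
  | zero =>
    rw [Subsingleton.elim (α := Fin 1) i (Fin.last 0)]
    exact (List.suffix_append _ _).isInfix
  | succ k ih =>
    rw [blockWord_succ]
    cases i using Fin.cases with
    | zero => exact ⟨[], [b] ++ blockWord a b fun i => r i.succ, by simp⟩
    | succ i => exact (ih (fun i => r i.succ) i).trans (List.suffix_append _ _).isInfix

theorem exists_blockWord_eq {α : Type*} (a b : α) {k : ℕ} (r : Fin (k + 1) → ℕ)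
    {i j : Fin (k + 1)} (hij : i < j) :
    ∃ x y, blockWord a b r = x ++ (List.replicate (r i) a ++ [b]) ++ y ∧
      List.replicate (r j) a <:+: y := by
  induction k with
  | zero => exact absurd (Subsingleton.elim (α := Fin 1) i j) hij.ne
  | succ k ih =>
    rw [blockWord_succ]
    cases j using Fin.cases with
    | zero => exact absurd hij (Fin.not_lt_zero i)
    | succ j =>
      cases i using Fin.cases with
      | zero => exact ⟨[], _, rfl, replicate_isInfix_blockWord a b (fun i => r i.succ) j⟩
      | succ i =>
        obtain ⟨x, y, h, hy⟩ := ih (fun i => r i.succ) (Fin.succ_lt_succ_iff.1 hij)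
        exact ⟨List.replicate (r 0) a ++ [b] ++ x, y, by rw [h]; simp, hy⟩

theorem exists_blockWord_eq_of_le {α : Type*} (a b : α) {k : ℕ} (r : Fin (k + 1) → ℕ)
    {i j : Fin (k + 1)} (hij : i ≠ j) {n : ℕ} (hi : n ≤ r i) (hj : n ≤ r j) :
    ∃ x y, blockWord a b r = x ++ (List.replicate n a ++ [b]) ++ y ∧
      List.replicate n a <:+: y := by
  wlog h : i < j generalizing i j
  · exact this hij.symm hj hi (lt_of_le_of_ne (not_lt.1 h) hij.symm)
  obtain ⟨x, y, hxy, hy⟩ := exists_blockWord_eq a b r h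
  refine ⟨x ++ List.replicate (r i - n) a, y, ?_, ?_⟩
  · rw [hxy]
    conv_lhs => rw [← Nat.sub_add_cancel hi, List.replicate_add]
    simp only [List.append_assoc]
  · refine List.IsInfix.trans ⟨[], List.replicate (r j - n) a, ?_⟩ hy
    rw [List.nil_append, ← List.replicate_add, Nat.add_sub_cancel' hj]

theorem two_le_card_factors_one {α : Type*} {a b : α} (hab : a ≠ b) {w : List α} (ha : a ∈ w)
    (hb : b ∈ w) : 2 ≤ (factors w 1).card := by
  classical
  have h : ({[a], [b]} : Finset (List α)) ⊆ factors w 1 := by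
    intro v hv
    simp only [Finset.mem_insert, Finset.mem_singleton] at hv
    rcases hv with rfl | rfl
    · exact mem_factors.2 ⟨(List.singleton_infix_iff _ _).2 ha, rfl⟩
    · exact mem_factors.2 ⟨(List.singleton_infix_iff _ _).2 hb, rfl⟩
  have h2 := Finset.card_le_card h
  rwa [Finset.card_pair (by simpa using hab)] at h2

theorem numPowers_add_le {α : Type*} {a b : α} (hab : a ≠ b) {w : List α} (ha : a ∈ w)
    (hb : b ∈ w) {m : ℕ}
    (hm : ∀ n ≤ m, ∃ x y, w = x ++ (List.replicate n a ++ [b]) ++ y ∧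
      List.replicate n a <:+: y) :
    numPowers w + m + 2 ≤ w.length := by
  classical
  -- Any linear order serves; it only selects Lyndon rotations.
  let _ : LinearOrder α := linearOrderOfSTO WellOrderingRel
  have hmw : m + 1 ≤ w.length := by
    obtain ⟨x, y, h, -⟩ := hm m le_rfl
    rw [h]; simp; omega
  -- There are no circuits at n = 0; each later n adds one inequality, improved by 1 when n ≤ m.
  have main : ∀ l, (∑ n ∈ Finset.range (l + 1), (circuitFinset w n).card) + min l m + 2 ≤
      (factors w (l + 1)).card + l := by
    intro l
    induction l with
    | zero => simpa [circuitFinset_zero] using two_le_card_factors_one hab ha hb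
    | succ l ih =>
      rw [Finset.sum_range_succ]
      by_cases hl : l + 1 ≤ m
      · obtain ⟨x, y, h, hy⟩ := hm (l + 1) hl
        have := card_factors_add_card_circuits_le_of_two_runs hab h hy
        omega
      · have := card_factors_add_card_circuits_le w (l + 1)
        omega
  have h1 := main (w.length - 1)
  have h2 := numPowers_le_sum_card_circuits w
  rw [Nat.sub_add_cancel (by omega), card_factors_length] at h1
  omega

theorem theorem3 {α : Type*} (a b : α) (hab : a ≠ b) (k : ℕ) (hk : 1 ≤ k)
    (r : Fin (k + 1) → ℕ) (w : List α) (hw : w = blockWord a b r) (ha : a ∈ w)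
    (σ : Equiv.Perm (Fin (k + 1))) (hσ : Monotone fun i => r (σ i)) :
    (numPowers w : ℤ) + (r (σ ⟨k - 1, by omega⟩) : ℤ) ≤ (w.length : ℤ) - 2 := by
  have hm : ∀ n ≤ r (σ ⟨k - 1, by omega⟩), ∃ x y,
      w = x ++ (List.replicate n a ++ [b]) ++ y ∧ List.replicate n a <:+: y := by
    intro n hn
    rw [hw]
    -- With indices from 0, positions k - 1 and k of the sorted order are the second largest and the
    -- largest run.
    refine exists_blockWord_eq_of_le a b r (i := σ ⟨k - 1, by omega⟩) (j := σ (Fin.last k))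
      ?_ hn (hn.trans (hσ (Fin.le_last _)))
    rw [Ne, σ.injective.eq_iff, Fin.ext_iff, Fin.val_last]
    change ¬ k - 1 = k
    omega
  have hb : b ∈ w := by
    obtain ⟨x, y, h, -⟩ := hm 0 (Nat.zero_le _)
    simp [h]
  have := numPowers_add_le hab ha hb hm
  omega
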